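/- Let $N\ge 1$ be an integer, let $K=[a,b]\subset\mathbb R$ ($a\le b$) be a closed segment and let $C\in\mathbb R$. Let $\mathcal M(\mathbb R)$ be the space of finite signed Borel measures on $\mathbb R$ with the weak topology $\sigma(\mathcal M(\mathbb R),C_b(\mathbb R))$, let $\mathcal M^N(\mathbb R)=\mathcal M(\mathbb R)^N$ carry the product topology, and for a closed subset $A$ of $\mathbb R$ or of $\mathbb R^N$ let $\mathcal P(A)$ be the set of Borel probability measures concentrated on $A$; tuples of probability measures are regarded as points of $\mathcal M^N(\mathbb R)$. For $l<r$ let $\mathcal D_{AC}[l,r]$ be the set of $\mu\in\mathcal P([l,r])$ having a density with respect to Lebesgue measure that is nonincreasing on $[l,r]$ (possibly infinite at $l$), and let $\mathcal D[l,r]$ be the set of measures $\alpha\delta_l+(1-\alpha)\mu'$ with $0\le\alpha\le1$ and $\mu'\in\mathcal D_{AC}[l,r]$; put $\mathcal D[l,l]=\{\delta_l\}$. Let $\mathcal V^N[C]$ be the set of $N$-tuples $(\mu_1,\dots,\mu_N)$ of Borel probability measures on $\mathbb R$ for which there are $l_1,\dots,l_N,r_1,\dots,r_N\in\mathbb R$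 with $$0\le r_k-l_k\le C-(l_1+\dots+l_N)\quad\text{and}\quad \mu_k\in\mathcal D[l_k,r_k]\qquad(k=1,\dots,N),$$ and such that $\sum_{k=1}^N\int x\,\mu_k(dx)=C$. Put $\mathcal V^N(K;C)=\mathcal V^N[C]\cap\mathcal P(K)^N$. Let $\mathcal F^N(K;C)$ be the set of $N$-tuples $(\mu_1,\dots,\mu_N)\in\mathcal P(K)^N$ for which there is $\gamma\in\mathcal P(K^N)$ with marginals $\mu_1,\dots,\mu_N$ that is concentrated on the hyperplane $\{x\in\mathbb R^N: x_1+\dots+x_N=C\}$. Theorem. The closed convex hull of $\mathcal V^N(K;C)$ in $\mathcal M^N(\mathbb R)$ equals $\mathcal F^N(K;C)$: $$\overline{\mathrm{co}}\,\mathcal V^N(K;C)=\mathcal F^N(K;C).$$ -/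

import Mathlib

open MeasureTheory Set
open scoped BoundedContinuousFunction NNReal ENNReal

noncomputable section

namespace FlatTuples

/-- Every bounded continuous function is integrable with respect to the (finite) total variation
of a signed measure on the real line. -/
theorem integrable_of_bcf (m : SignedMeasure ℝ) (f : ℝ →ᵇ ℝ) :
    VectorMeasure.Integrable m (fun x => f x) := by
  have : IsFiniteMeasure m.variation := by
    rw [← SignedMeasure.totalVariation_eq_variation]
    infer_instance
  exact f.integrable m.variation

/-- The bilinear pairing `(m, f) ↦ ∫ f dm` between finite signed Borel measures on the real line
and bounded continuous functions. -/
def pairing : SignedMeasure ℝ →ₗ[ℝ] (ℝ →ᵇ ℝ) →ₗ[ℝ] ℝ :=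
  LinearMap.mk₂ ℝ
    (fun m f => VectorMeasure.integral m (fun x => f x) (ContinuousLinearMap.lsmul ℝ ℝ).flip)
    (fun m₁ m₂ f => VectorMeasure.integral_add_vectorMeasure
      (integrable_of_bcf m₁ f) (integrable_of_bcf m₂ f))
    (fun c _ _ => VectorMeasure.integral_smul_vectorMeasure _ c)
    (fun m f₁ f₂ => VectorMeasure.integral_add
      (integrable_of_bcf m f₁) (integrable_of_bcf m f₂))
    (fun c m f => VectorMeasure.integral_smul (f := fun x => f x) m _ c)

/-- On nonnegative finite measures the pairing is the usual Lebesgue integral. -/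
theorem pairing_toSignedMeasure (μ : Measure ℝ) [IsFiniteMeasure μ] (f : ℝ →ᵇ ℝ) :
    pairing μ.toSignedMeasure f = ∫ x, f x ∂μ :=
  VectorMeasure.integral_toSignedMeasure (μ := μ) (f := fun x => f x)

/-- The locally convex space `M(ℝ)` of finite signed Borel measures on the real line, with the
weak topology `σ(M(ℝ), C_b(ℝ))`. -/
abbrev SignedMeasureSpace : Type := WeakBilin pairing

/-- A tuple of probability measures as a point of the product space `M(ℝ)^N`. -/
def toSignedTuple {N : ℕ} (μ : Fin N → ProbabilityMeasure ℝ) : Fin N → SignedMeasureSpace :=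
  fun k => (μ k : Measure ℝ).toSignedMeasure

/-- `P(K)`, seen inside `P(X)`: the probability measures on `X` concentrated on `K`. -/
def probOn {X : Type*} [MeasurableSpace X] (K : Set X) : Set (ProbabilityMeasure X) :=
  {μ | (μ : Measure X) Kᶜ = 0}

/-- `D_AC[l, r]`: probability measures on `[l, r]` having a density with respect to Lebesgue
measure that is nonincreasing on `[l, r]` (the value `∞` is allowed for the density; by
integrability it can then occur only at `l`). -/
def decreasingAC (l r : ℝ) : Set (ProbabilityMeasure ℝ) :=
  {μ | μ ∈ probOn (Icc l r) ∧ ∃ ρ : ℝ → ℝ≥0∞, AntitoneOn ρ (Icc l r) ∧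
    (μ : Measure ℝ) = (volume.restrict (Icc l r)).withDensity ρ}

/-- `D[l, r]`: for `l < r`, the probability measures on `[l, r]` of the form `α δ(l) + β μ'` with
`α, β ≥ 0`, `α + β = 1` and `μ' ∈ D_AC[l, r]`; moreover `D[l, l] = {δ(l)}`. -/
def decreasing (l r : ℝ) : Set (ProbabilityMeasure ℝ) :=
  {μ | μ ∈ probOn (Icc l r) ∧
    ((l = r ∧ (μ : Measure ℝ) = Measure.dirac l) ∨
      (l < r ∧ ∃ α β : ℝ≥0, α + β = 1 ∧ ∃ μ' ∈ decreasingAC l r,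
        (μ : Measure ℝ) = α • Measure.dirac l + β • (μ' : Measure ℝ)))}

/-- `(l, r)` is a `C`-compatible boundary. -/
def IsCompatibleBoundary {N : ℕ} (C : ℝ) (l r : Fin N → ℝ) : Prop :=
  ∀ k, 0 ≤ r k - l k ∧ r k - l k ≤ C - ∑ i, l i

/-- `V^N[C]`. -/
def V (N : ℕ) (C : ℝ) : Set (Fin N → ProbabilityMeasure ℝ) :=
  {μ | ∑ k, ∫ x, x ∂(μ k : Measure ℝ) = C ∧
    ∃ l r : Fin N → ℝ, IsCompatibleBoundary C l r ∧ ∀ k, μ k ∈ decreasing (l k) (r k)}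

/-- `V^N(K; C) = V^N[C] ∩ P^N(K)`. -/
def VOn (N : ℕ) (K : Set ℝ) (C : ℝ) : Set (Fin N → ProbabilityMeasure ℝ) :=
  V N C ∩ {μ | ∀ k, μ k ∈ probOn K}

/-- `F^N(K; C)`: the tuples in `P(K)^N` which are the tuple of marginals of some probability
measure `γ` on `K^N` concentrated on the hyperplane `{x_1 + ⋯ + x_N = C}`. -/
def F (N : ℕ) (K : Set ℝ) (C : ℝ) : Set (Fin N → ProbabilityMeasure ℝ) :=
  {μ | (∀ k, μ k ∈ probOn K) ∧
    ∃ γ : ProbabilityMeasure (Fin N → ℝ), γ ∈ probOn (univ.pi fun _ => K) ∧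
      γ ∈ probOn {x : Fin N → ℝ | ∑ i, x i = C} ∧
      ∀ k, (γ : Measure (Fin N → ℝ)).map (fun x => x k) = (μ k : Measure ℝ)}

end FlatTuples

end

noncomputable section

namespace FlatTuples

/-! The set F is convex and compact: it is the image of the probability measures on the compact
slice {x in K^N : sum x = C} under the continuous map to marginals. Dirac tuples at points of the
slice lie in V (take l = r), and their closed convex hull already contains F, since a separating
tuple of functions can be integrated against a coupling. What remains is V ⊆ F, which by Hahn–Banach
is the dual inequality `dual_inequality`: if u ≤ ∑ f_k(z_k) on the slice, then u ≤ ∑ ∫ f_k dμ_k.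

A measure in D[l, r] is a mixture of uniform laws on [l, l + t], including the Dirac mass t = 0, so
its integrals are bounded below through averages over initial segments. The constraint on the means
is absorbed by a multiplier: 2c(x - l_k) is subtracted from f_k, with t_k minimizing the resulting
average. With D = C - ∑ l_k, the multiplier can be chosen so that D ≤ ∑ t_k ≤ 2D (`exists_slope`).

At a minimizer t_k, averages over tails [t_k - y, t_k] are at most the minimum (`average_tail_le`).
So it suffices to couple uniform laws on such tails with constant sum D. This is possible when the
tail lengths are the sides of a polygon with semiperimeter ∑ t_k - D; polygons reduce to triangles,
and a triangle is handled by an explicit closed path (`triangle_uniform`). -/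

/-! ### Couplings as measures on the compact slice -/

/-- The part of the cube `K^N`, `K = [a, b]`, on the hyperplane `x_1 + ⋯ + x_N = C`. -/
def slice (N : ℕ) (a b C : ℝ) : Set (Fin N → ℝ) :=
  {x | (∀ k, x k ∈ Icc a b) ∧ ∑ k, x k = C}

theorem isCompact_slice (N : ℕ) (a b C : ℝ) : IsCompact (slice N a b C) := by
  have h : slice N a b C = (univ.pi fun _ => Icc a b) ∩ {x | ∑ k, x k = C} := by
    ext x; simp only [slice, mem_inter_iff, mem_pi, mem_univ, true_imp_iff]; rfl
  rw [h]
  exact (isCompact_univ_pi fun _ => isCompact_Icc).inter_right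
    (isClosed_eq (by fun_prop) continuous_const)

theorem measurableSet_slice (N : ℕ) (a b C : ℝ) : MeasurableSet (slice N a b C) :=
  (isCompact_slice N a b C).isClosed.measurableSet

theorem continuous_slice_coord {N : ℕ} {a b C : ℝ} (k : Fin N) :
    Continuous fun z : slice N a b C => z.1 k :=
  (continuous_apply k).comp continuous_subtype_val

/-- The tuple of marginals of a probability measure on the slice. -/
def marginals {N : ℕ} {a b C : ℝ} (γ : ProbabilityMeasure (slice N a b C)) :
    Fin N → ProbabilityMeasure ℝ :=
  fun k => γ.map (continuous_slice_coord k).measurable.aemeasurable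

theorem F_eq_range_marginals (N : ℕ) (a b C : ℝ) :
    F N (Icc a b) C = range (marginals (N := N) (a := a) (b := b) (C := C)) := by
  ext μ
  constructor
  · rintro ⟨-, γ, hK, hC, hm⟩
    have hae : ∀ᵐ x ∂(γ : Measure (Fin N → ℝ)), x ∈ slice N a b C := by
      have h1 : ∀ᵐ x ∂(γ : Measure (Fin N → ℝ)), x ∈ (univ.pi fun _ => Icc a b) := hK
      have h2 : ∀ᵐ x ∂(γ : Measure (Fin N → ℝ)), x ∈ {x : Fin N → ℝ | ∑ i, x i = C} := hC
      filter_upwards [h1, h2] with x hx hx'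
      exact ⟨fun k => hx k (mem_univ k), hx'⟩
    have hmap : ((γ : Measure (Fin N → ℝ)).comap ((↑) : slice N a b C → Fin N → ℝ)).map (↑) =
        (γ : Measure (Fin N → ℝ)) := by
      rw [map_comap_subtype_coe (measurableSet_slice N a b C),
        Measure.restrict_eq_self_of_ae_mem hae]
    have hprob : IsProbabilityMeasure
        ((γ : Measure (Fin N → ℝ)).comap ((↑) : slice N a b C → Fin N → ℝ)) := by
      constructor
      have := congrArg (fun ν : Measure (Fin N → ℝ) => ν univ) hmap
      simpa [Measure.map_apply measurable_subtype_coe MeasurableSet.univ] using this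
    refine ⟨⟨_, hprob⟩, ?_⟩
    funext k
    apply Subtype.ext
    change Measure.map _ ((γ : Measure (Fin N → ℝ)).comap _) = (μ k : Measure ℝ)
    rw [← hm k, ← hmap, Measure.map_map (measurable_pi_apply k) measurable_subtype_coe, hmap]
    rfl
  · rintro ⟨γ, rfl⟩
    have hval : Measurable ((↑) : slice N a b C → Fin N → ℝ) := measurable_subtype_coe
    refine ⟨fun k => ?_, γ.map hval.aemeasurable, ?_, ?_, fun k => ?_⟩
    · change Measure.map _ _ _ = 0
      rw [Measure.map_apply (continuous_slice_coord k).measurable measurableSet_Icc.compl]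
      convert measure_empty (μ := (γ : Measure (slice N a b C)))
      ext z
      simpa using z.2.1 k
    · change Measure.map _ _ _ = 0
      rw [Measure.map_apply hval (MeasurableSet.univ_pi fun _ => measurableSet_Icc).compl]
      convert measure_empty (μ := (γ : Measure (slice N a b C)))
      ext z
      simpa only [preimage_compl, mem_compl_iff, mem_preimage, mem_pi, mem_univ, true_imp_iff,
        mem_empty_iff_false, iff_false, not_not] using z.2.1
    · change Measure.map _ _ _ = 0
      rw [Measure.map_apply hval
        (measurableSet_eq_fun (by fun_prop) measurable_const).compl]
      convert measure_empty (μ := (γ : Measure (slice N a b C)))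
      ext z
      simpa using z.2.2
    · change Measure.map _ (Measure.map _ _) = Measure.map _ _
      rw [Measure.map_map (measurable_pi_apply k) hval]
      rfl

theorem integral_marginals {N : ℕ} {a b C : ℝ} (γ : ProbabilityMeasure (slice N a b C))
    (k : Fin N) (f : ℝ →ᵇ ℝ) :
    ∫ x, f x ∂(marginals γ k : Measure ℝ) = ∫ z : slice N a b C, f (z.1 k) ∂γ :=
  integral_map (continuous_slice_coord k).measurable.aemeasurable
    f.continuous.aestronglyMeasurable

theorem pairing_toSignedTuple {N : ℕ} (μ : Fin N → ProbabilityMeasure ℝ) (k : Fin N)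
    (f : ℝ →ᵇ ℝ) : pairing (toSignedTuple μ k) f = ∫ x, f x ∂(μ k : Measure ℝ) :=
  pairing_toSignedMeasure _ f

/-! ### The weak topology; F is compact and convex -/

/-- Bounded continuous functions distinguish the two halves of the Jordan decomposition. This makes
the weak topology Hausdorff, so that compact sets are closed. -/
theorem pairing_injective : Function.Injective pairing := by
  rw [injective_iff_map_eq_zero]
  intro m hm
  set j := SignedMeasure.toJordanDecomposition m with hj
  have h : j.posPart.toSignedMeasure - j.negPart.toSignedMeasure = m :=
    SignedMeasure.toSignedMeasure_toJordanDecomposition m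
  have heq : j.posPart = j.negPart := by
    refine ext_of_forall_integral_eq_of_IsFiniteMeasure fun f => ?_
    have := LinearMap.congr_fun hm f
    rw [← h, map_sub, LinearMap.sub_apply, pairing_toSignedMeasure,
      pairing_toSignedMeasure] at this
    exact sub_eq_zero.1 this
  rw [← h]
  simp [heq]

instance : T2Space SignedMeasureSpace :=
  (WeakBilin.isEmbedding pairing_injective).t2Space

theorem continuous_toSignedTuple_marginals (N : ℕ) (a b C : ℝ) :
    Continuous fun γ : ProbabilityMeasure (slice N a b C) => toSignedTuple (marginals γ) := by
  refine continuous_pi fun k => WeakBilin.continuous_of_continuous_eval _ fun f => ?_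
  simp only [pairing_toSignedTuple, integral_marginals]
  exact ProbabilityMeasure.continuous_integral_boundedContinuousFunction
    (f.compContinuous ⟨_, continuous_slice_coord k⟩)

theorem isClosed_F (N : ℕ) (a b C : ℝ) : IsClosed (toSignedTuple '' F N (Icc a b) C) := by
  have : CompactSpace (slice N a b C) := isCompact_iff_compactSpace.1 (isCompact_slice N a b C)
  rw [F_eq_range_marginals, ← range_comp]
  exact (isCompact_range (continuous_toSignedTuple_marginals N a b C)).isClosed

theorem convex_F (N : ℕ) (a b C : ℝ) : Convex ℝ (toSignedTuple '' F N (Icc a b) C) := by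
  rw [F_eq_range_marginals, ← range_comp]
  rintro _ ⟨γ₁, rfl⟩ _ ⟨γ₂, rfl⟩ s t hs ht hst
  have hp : IsProbabilityMeasure (s.toNNReal • (γ₁ : Measure (slice N a b C)) +
      t.toNNReal • (γ₂ : Measure (slice N a b C))) := by
    constructor
    rw [Measure.add_apply, Measure.smul_apply, Measure.smul_apply, measure_univ, measure_univ,
      ENNReal.smul_def, ENNReal.smul_def, smul_eq_mul, smul_eq_mul, mul_one, mul_one]
    rw [← ENNReal.coe_add, ← Real.toNNReal_add hs ht, hst]
    simp
  refine ⟨⟨_, hp⟩, ?_⟩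
  funext k
  change (Measure.map (fun z : slice N a b C => z.1 k) (s.toNNReal • (γ₁ : Measure (slice N a b C)) +
      t.toNNReal • (γ₂ : Measure (slice N a b C)))).toSignedMeasure =
    s • (Measure.map (fun z : slice N a b C => z.1 k) γ₁).toSignedMeasure +
    t • (Measure.map (fun z : slice N a b C => z.1 k) γ₂).toSignedMeasure
  ext A hA
  have hmeas := (continuous_slice_coord (a := a) (b := b) (C := C) k).measurable
  have hA' := hmeas hA
  rw [Measure.toSignedMeasure_apply_measurable hA]
  rw [_root_.add_apply, _root_.smul_apply, _root_.smul_apply]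
  rw [Measure.toSignedMeasure_apply_measurable hA, Measure.toSignedMeasure_apply_measurable hA]
  simp only [map_measureReal_apply hmeas hA]
  rw [measureReal_add_apply, measureReal_nnreal_smul_apply, measureReal_nnreal_smul_apply]
  simp [hs, ht]

/-! ### Reduction to a dual inequality by Hahn–Banach -/

/-- A tuple outside a closed convex set is strictly separated from it by a tuple of bounded
continuous functions. -/
theorem exists_separation {N : ℕ} {S : Set (Fin N → SignedMeasureSpace)} (hS : Convex ℝ S)
    (hS' : IsClosed S) {μ : Fin N → ProbabilityMeasure ℝ} (hμ : toSignedTuple μ ∉ S) :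
    ∃ (f : Fin N → ℝ →ᵇ ℝ) (u : ℝ), ∑ k, ∫ x, f k x ∂(μ k : Measure ℝ) < u ∧
      ∀ ν : Fin N → ProbabilityMeasure ℝ, toSignedTuple ν ∈ S →
        u < ∑ k, ∫ x, f k x ∂(ν k : Measure ℝ) := by
  have : LocallyConvexSpace ℝ (Fin N → SignedMeasureSpace) := inferInstance
  obtain ⟨φ, u, h1, h2⟩ := geometric_hahn_banach_point_closed hS hS' hμ
  have hrep : ∀ k, ∃ f : ℝ →ᵇ ℝ, ∀ m : SignedMeasureSpace,
      φ (Pi.single k m) = pairing m f := by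
    intro k
    -- Every weakly continuous functional on M(ℝ) is integration of some f in C_b.
    obtain ⟨f, hf⟩ := LinearMap.dualEmbedding_surjective pairing
      (φ.comp (ContinuousLinearMap.single ℝ (fun _ : Fin N => SignedMeasureSpace) k))
    exact ⟨f, fun m => (DFunLike.congr_fun hf m).symm⟩
  choose f hf using hrep
  have key : ∀ ν : Fin N → ProbabilityMeasure ℝ,
      φ (toSignedTuple ν) = ∑ k, ∫ x, f k x ∂(ν k : Measure ℝ) := by
    intro ν
    conv_lhs => rw [← Finset.univ_sum_single (toSignedTuple ν)]
    rw [map_sum]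
    exact Finset.sum_congr rfl fun k _ => by rw [hf, pairing_toSignedTuple]
  exact ⟨f, u, key μ ▸ h1, fun ν hν => key ν ▸ h2 _ hν⟩

/-- The tuple of Dirac measures at the coordinates of a point. -/
def diracTuple {N : ℕ} (x : Fin N → ℝ) : Fin N → ProbabilityMeasure ℝ :=
  fun k => ⟨Measure.dirac (x k), inferInstance⟩

theorem integral_diracTuple {N : ℕ} (x : Fin N → ℝ) (k : Fin N) (f : ℝ → ℝ) :
    ∫ y, f y ∂(diracTuple x k : Measure ℝ) = f (x k) :=
  integral_dirac f (x k)

theorem diracTuple_mem_VOn {N : ℕ} {a b C : ℝ} {x : Fin N → ℝ} (hx : x ∈ slice N a b C) :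
    diracTuple x ∈ VOn N (Icc a b) C := by
  refine ⟨⟨?_, x, x, fun k => ?_, fun k => ⟨?_, Or.inl ⟨rfl, rfl⟩⟩⟩, fun k => ?_⟩
  · simpa only [integral_diracTuple] using hx.2
  · simp [hx.2]
  · change Measure.dirac (x k) (Icc (x k) (x k))ᶜ = 0
    simp
  · change Measure.dirac (x k) (Icc a b)ᶜ = 0
    rw [Measure.dirac_apply' _ measurableSet_Icc.compl]
    simpa using hx.1 k

theorem F_diracTuple {N : ℕ} {a b C : ℝ} {z : Fin N → ℝ} (hz : z ∈ slice N a b C) :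
    toSignedTuple (diracTuple z) ∈ toSignedTuple '' F N (Icc a b) C := by
  refine mem_image_of_mem _ ?_
  rw [F_eq_range_marginals]
  refine ⟨⟨Measure.dirac ⟨z, hz⟩, inferInstance⟩, ?_⟩
  funext k
  apply Subtype.ext
  exact Measure.map_dirac' (continuous_slice_coord k).measurable _

theorem le_sum_integral_marginals {N : ℕ} {a b C : ℝ} (γ : ProbabilityMeasure (slice N a b C))
    (f : Fin N → ℝ →ᵇ ℝ) {u : ℝ} (hle : ∀ z ∈ slice N a b C, u ≤ ∑ k, f k (z k)) :
    u ≤ ∑ k, ∫ x, f k x ∂(marginals γ k : Measure ℝ) := by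
  have hint : ∀ k, Integrable (fun z : slice N a b C => f k (z.1 k))
      (γ : Measure (slice N a b C)) := fun k =>
    ((f k).compContinuous ⟨_, continuous_slice_coord k⟩).integrable _
  simp only [integral_marginals]
  rw [← integral_finsetSum _ fun k _ => hint k]
  calc u = ∫ _ : slice N a b C, u ∂γ := by simp
    _ ≤ _ := integral_mono (integrable_const _) (integrable_finsetSum _ fun k _ => hint k)
      fun z => hle z.1 z.2

/-- A functional that exceeds u at all Dirac tuples of the slice is at least u at the marginals of
γ, by integration over γ; hence nothing separates these marginals from S. -/
theorem F_subset_of_dirac {N : ℕ} {a b C : ℝ} {S : Set (Fin N → SignedMeasureSpace)}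
    (hc : Convex ℝ S) (hcl : IsClosed S)
    (hS : ∀ z ∈ slice N a b C, toSignedTuple (diracTuple z) ∈ S) :
    toSignedTuple '' F N (Icc a b) C ⊆ S := by
  rw [F_eq_range_marginals]
  rintro _ ⟨_, ⟨γ, rfl⟩, rfl⟩
  by_contra hγ
  obtain ⟨f, u, h1, h2⟩ := exists_separation hc hcl hγ
  refine absurd h1 (not_lt.2 (le_sum_integral_marginals γ f fun z hz => ?_))
  have := h2 _ (hS z hz)
  simp only [integral_diracTuple] at this
  exact this.le

theorem F_subset_closedConvexHull (N : ℕ) (a b C : ℝ) :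
    toSignedTuple '' F N (Icc a b) C ⊆
      closedConvexHull ℝ (toSignedTuple '' VOn N (Icc a b) C) :=
  F_subset_of_dirac convex_closedConvexHull isClosed_closedConvexHull fun _ hz =>
    subset_closedConvexHull (mem_image_of_mem _ (diracTuple_mem_VOn hz))

theorem VOn_subset_F_of_duality {N : ℕ} {a b C : ℝ}
    (h : ∀ μ ∈ VOn N (Icc a b) C, ∀ (f : Fin N → ℝ →ᵇ ℝ) (u : ℝ),
      (∀ z ∈ slice N a b C, u ≤ ∑ k, f k (z k)) →
        u ≤ ∑ k, ∫ x, f k x ∂(μ k : Measure ℝ)) :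
    toSignedTuple '' VOn N (Icc a b) C ⊆ toSignedTuple '' F N (Icc a b) C := by
  rintro _ ⟨μ, hμ, rfl⟩
  by_contra hn
  obtain ⟨f, u, h1, h2⟩ := exists_separation (convex_F N a b C) (isClosed_F N a b C) hn
  refine absurd h1 (not_lt.2 (h μ hμ f u fun z hz => ?_))
  have := h2 _ (F_diracTuple hz)
  simp only [integral_diracTuple] at this
  exact this.le

/-! ### Joint mixability of uniform laws on the sides of a polygon -/

/-- Averaging over the closed path `0 → 1 → c → 0`, `c = Y / (Y + Z)`, traversed in time
proportional to `Y Z`, `X Z`, `X Y`, is the same as averaging over `[0, 1]`. -/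
theorem weighted_path_integral {e : ℝ → ℝ} (he : Continuous e) (X : ℝ) {Y Z : ℝ}
    (h : Y + Z ≠ 0) :
    Y * Z * (∫ v in (0 : ℝ)..1, e v)
      + X * Z * (∫ v in (0 : ℝ)..1, e (1 + (Y / (Y + Z) - 1) * v))
      + X * Y * (∫ v in (0 : ℝ)..1, e (Y / (Y + Z) + -(Y / (Y + Z)) * v)) =
    (X * Y + Y * Z + X * Z) * ∫ v in (0 : ℝ)..1, e v := by
  set c := Y / (Y + Z) with hc
  have h1 := intervalIntegral.mul_integral_comp_add_mul (f := e) (a := 0) (b := 1) (c - 1) 1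
  have h2 := intervalIntegral.mul_integral_comp_add_mul (f := e) (a := 0) (b := 1) (-c) c
  have h3 := intervalIntegral.integral_add_adjacent_intervals
    (he.intervalIntegrable (μ := volume) 0 c) (he.intervalIntegrable c 1)
  have hY : Y = c * (Y + Z) := by rw [hc]; field_simp
  have hZ : Z = (1 - c) * (Y + Z) := by linear_combination -hY
  clear_value c
  rw [show (1 : ℝ) + (c - 1) * 0 = 1 by ring, show (1 : ℝ) + (c - 1) * 1 = c by ring,
    intervalIntegral.integral_symm c 1] at h1
  rw [show c + -c * 0 = c by ring, show c + -c * 1 = 0 by ring,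
    intervalIntegral.integral_symm 0 c] at h2
  linear_combination (-X * (Y + Z)) * h1 + (-X * (Y + Z)) * h2 + (X * (Y + Z)) * h3
    + (X * ∫ v in (0 : ℝ)..1, e (1 + (c - 1) * v)) * hZ
    + (X * ∫ v in (0 : ℝ)..1, e (c + -c * v)) * hY

theorem integral_sum_three {e : Fin 3 → ℝ → ℝ} {w : Fin 3 → ℝ → ℝ} {u : ℝ}
    (he : ∀ i, Continuous (e i)) (hw : ∀ i, Continuous (w i))
    (h : ∀ v ∈ Icc (0 : ℝ) 1, u ≤ ∑ i, e i (w i v)) :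
    u ≤ ∑ i, ∫ v in (0 : ℝ)..1, e i (w i v) := by
  have hi : ∀ i, IntervalIntegrable (fun v => e i (w i v)) volume 0 1 := fun i =>
    ((he i).comp (hw i)).intervalIntegrable _ _
  rw [← intervalIntegral.integral_finsetSum fun i _ => hi i]
  calc u = ∫ _ in (0 : ℝ)..1, u := by simp
    _ ≤ _ := intervalIntegral.integral_mono_on zero_le_one (by simp)
      ((continuous_finsetSum _ fun i _ => (he i).comp (hw i)).intervalIntegrable _ _) h

theorem integral_one_sub (e : ℝ → ℝ) :
    ∫ v in (0 : ℝ)..1, e (1 + -1 * v) = ∫ v in (0 : ℝ)..1, e v := by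
  have := intervalIntegral.integral_comp_sub_left (a := 0) (b := 1) e 1
  simpa [sub_eq_add_neg] using this

/-- The coupling lives on the boundary of a triangle inside {∑ p_i s_i = E}. Along this closed path
each coordinate sweeps [0, 1] once on one edge and returns on the other two; suitable edge weights
make all three coordinates uniform. -/
theorem triangle_uniform {e : Fin 3 → ℝ → ℝ} (he : ∀ i, Continuous (e i)) {p : Fin 3 → ℝ}
    {E u : ℝ} (hp : ∀ i, 0 ≤ p i) (hpE : ∀ i, p i ≤ E) (hsum : ∑ i, p i = 2 * E)
    (h : ∀ s : Fin 3 → ℝ, (∀ i, s i ∈ Icc (0 : ℝ) 1) → ∑ i, p i * s i = E → u ≤ ∑ i, e i (s i)) :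
    u ≤ ∑ i, ∫ v in (0 : ℝ)..1, e i v := by
  have key : ∀ α β : Fin 3 → ℝ, (∀ i, 0 ≤ α i ∧ α i ≤ 1) → (∀ i, 0 ≤ β i ∧ β i ≤ 1) →
      ∑ i, p i * α i = E → ∑ i, p i * β i = E →
      u ≤ ∑ i, ∫ v in (0 : ℝ)..1, e i (α i + (β i - α i) * v) := by
    intro α β hα hβ hαE hβE
    refine integral_sum_three (w := fun i v => α i + (β i - α i) * v) he
      (fun i => by fun_prop) fun v hv => h _ (fun i => ⟨?_, ?_⟩) ?_
    · nlinarith [mul_nonneg (hα i).1 (sub_nonneg.2 hv.2), mul_nonneg (hβ i).1 hv.1]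
    · nlinarith [mul_nonneg (sub_nonneg.2 (hα i).2) (sub_nonneg.2 hv.2),
        mul_nonneg (sub_nonneg.2 (hβ i).2) hv.1]
    · rw [Fin.sum_univ_three] at hαE hβE ⊢
      linear_combination (1 - v) * hαE + v * hβE
  have h0 := hp 0
  have h1 := hp 1
  have h2 := hp 2
  have h0' := hpE 0
  have h1' := hpE 1
  have h2' := hpE 2
  rw [Fin.sum_univ_three] at hsum
  rcases eq_or_lt_of_le h0 with z0 | z0
  -- If p 0 = 0, the other two sides both equal E, and the single segment s 2 = 1 - s 1 suffices.
  -- The next two cases are analogous.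
  · have := key ![0, 0, 1] ![1, 1, 0] (by simp [Fin.forall_fin_succ])
      (by simp [Fin.forall_fin_succ]) (by simp [Fin.sum_univ_three]; linarith)
      (by simp [Fin.sum_univ_three]; linarith)
    simpa [Fin.sum_univ_three, ← integral_one_sub (e 2)] using this
  rcases eq_or_lt_of_le h1 with z1 | z1
  · have := key ![0, 0, 1] ![1, 1, 0] (by simp [Fin.forall_fin_succ])
      (by simp [Fin.forall_fin_succ]) (by simp [Fin.sum_univ_three]; linarith)
      (by simp [Fin.sum_univ_three]; linarith)
    simpa [Fin.sum_univ_three, ← integral_one_sub (e 2)] using this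
  rcases eq_or_lt_of_le h2 with z2 | z2
  · have := key ![0, 1, 0] ![1, 0, 1] (by simp [Fin.forall_fin_succ])
      (by simp [Fin.forall_fin_succ]) (by simp [Fin.sum_univ_three]; linarith)
      (by simp [Fin.sum_univ_three]; linarith)
    simpa [Fin.sum_univ_three, ← integral_one_sub (e 1)] using this
  -- X, Y, Z are the slacks in the triangle inequalities; each side is the sum of two of them.
  obtain ⟨X, hX⟩ : ∃ X, X = E - p 0 := ⟨_, rfl⟩
  obtain ⟨Y, hY⟩ : ∃ Y, Y = E - p 1 := ⟨_, rfl⟩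
  obtain ⟨Z, hZ⟩ : ∃ Z, Z = E - p 2 := ⟨_, rfl⟩
  have e0 : p 0 = Y + Z := by linarith
  have e1 : p 1 = Z + X := by linarith
  have e2 : p 2 = X + Y := by linarith
  have hE : E = X + Y + Z := by linarith
  have X0 : 0 ≤ X := by linarith
  have Y0 : 0 ≤ Y := by linarith
  have Z0 : 0 ≤ Z := by linarith
  rw [e0] at z0
  rw [e1] at z1
  rw [e2] at z2
  have frac : ∀ x y : ℝ, 0 ≤ x → 0 ≤ y → 0 ≤ x / (x + y) ∧ x / (x + y) ≤ 1 := fun x y hx hy =>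
    ⟨by positivity, div_le_one_of_le₀ (by linarith) (by linarith)⟩
  have mulfrac : ∀ x y : ℝ, 0 < x + y → (x + y) * (x / (x + y)) = x := fun x y hxy => by
    field_simp
  have bA : ∀ i, 0 ≤ (![0, Z / (Z + X), 1] : Fin 3 → ℝ) i ∧
      (![0, Z / (Z + X), 1] : Fin 3 → ℝ) i ≤ 1 := by
    simp [Fin.forall_fin_succ, frac Z X Z0 X0]
  have bB : ∀ i, 0 ≤ (![1, 0, X / (X + Y)] : Fin 3 → ℝ) i ∧
      (![1, 0, X / (X + Y)] : Fin 3 → ℝ) i ≤ 1 := by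
    simp [Fin.forall_fin_succ, frac X Y X0 Y0]
  have bC : ∀ i, 0 ≤ (![Y / (Y + Z), 1, 0] : Fin 3 → ℝ) i ∧
      (![Y / (Y + Z), 1, 0] : Fin 3 → ℝ) i ≤ 1 := by
    simp [Fin.forall_fin_succ, frac Y Z Y0 Z0]
  have sA : ∑ i, p i * (![0, Z / (Z + X), 1] : Fin 3 → ℝ) i = E := by
    simp [Fin.sum_univ_three, e1, e2, hE, mulfrac Z X z1]; ring
  have sB : ∑ i, p i * (![1, 0, X / (X + Y)] : Fin 3 → ℝ) i = E := by
    simp [Fin.sum_univ_three, e0, e2, hE, mulfrac X Y z2]; ring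
  have sC : ∑ i, p i * (![Y / (Y + Z), 1, 0] : Fin 3 → ℝ) i = E := by
    simp [Fin.sum_univ_three, e0, e1, hE, mulfrac Y Z z0]; ring
  have iAB := key _ _ bA bB sA sB
  have iBC := key _ _ bB bC sB sC
  have iCA := key _ _ bC bA sC sA
  have w0 := weighted_path_integral (he 0) X z0.ne'
  have w1 := weighted_path_integral (he 1) Y z1.ne'
  have w2 := weighted_path_integral (he 2) Z z2.ne'
  simp only [Fin.sum_univ_three, Matrix.cons_val_zero, Matrix.cons_val_one, Matrix.cons_val,
    zero_add, zero_sub, sub_zero, one_mul] at iAB iBC iCA ⊢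
  have hW : 0 < X * Y + Y * Z + X * Z := by
    rcases eq_or_lt_of_le X0 with hx | hx
    · have : 0 < Y := by linarith
      have : 0 < Z := by linarith
      nlinarith [mul_pos ‹0 < Y› ‹0 < Z›]
    · nlinarith [mul_pos hx z0, mul_nonneg Y0 Z0]
  -- Edges AB, BC, CA carry weights YZ, XZ, XY.
  refine le_of_mul_le_mul_left ?_ hW
  nlinarith [mul_le_mul_of_nonneg_left iAB (mul_nonneg Y0 Z0),
    mul_le_mul_of_nonneg_left iBC (mul_nonneg X0 Z0),
    mul_le_mul_of_nonneg_left iCA (mul_nonneg X0 Y0)]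

/-- Sides of a polygon can be grouped into the sides of a (possibly degenerate) triangle. -/
theorem exists_grouping {ι : Type*} [Fintype ι] [DecidableEq ι] {y : ι → ℝ} {E : ℝ}
    (hy : ∀ k, 0 ≤ y k) (hyE : ∀ k, y k ≤ E) (hE : 0 ≤ E) (hsum : ∑ k, y k = 2 * E) :
    ∃ g : ι → Fin 3, ∀ i, ∑ k with g k = i, y k ≤ E := by
  obtain ⟨A, hA⟩ := (Set.toFinite {A : Finset ι | ∑ k ∈ A, y k ≤ E}).exists_maximal
    ⟨∅, by simpa using hE⟩
  have hAE : ∑ k ∈ A, y k ≤ E := hA.prop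
  by_cases hU : A = Finset.univ
  · have hz : ∑ k, y k ≤ E := hU ▸ hAE
    refine ⟨fun _ => 0, fun i => le_trans ?_ hz⟩
    exact Finset.sum_le_sum_of_subset_of_nonneg (Finset.filter_subset _ _) fun k _ _ => hy k
  · obtain ⟨j, hj⟩ : ∃ j, j ∉ A := by
      by_contra! hh
      exact hU (Finset.eq_univ_iff_forall.2 hh)
    have hlt : E < ∑ k ∈ insert j A, y k := by
      by_contra! hh
      exact hj (hA.le_of_ge (y := insert j A) hh (Finset.subset_insert j A)
        (Finset.mem_insert_self j A))
    -- The groups are a maximal A of sum at most E, one further side j, and the rest. The rest has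
    -- sum below E because A and j together exceed half of 2E.
    refine ⟨fun k => if k ∈ A then 0 else if k = j then 1 else 2, fun i => ?_⟩
    fin_cases i
    · convert hAE using 2
      ext k
      by_cases hk : k ∈ A <;> by_cases hkj : k = j <;> simp [hk, hkj]
    · have : (Finset.univ.filter fun k => (if k ∈ A then (0 : Fin 3) else if k = j then 1 else 2) =
          1) = {j} := by
        ext k
        by_cases hk : k ∈ A <;> by_cases hkj : k = j <;> simp [hk, hkj]
        · exact fun h => hj (hkj ▸ hk)
        · exact hkj ▸ hj
      simpa [this] using hyE j
    · have : (Finset.univ.filter fun k => (if k ∈ A then (0 : Fin 3) else if k = j then 1 else 2) =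
          2) = (insert j A)ᶜ := by
        ext k
        by_cases hk : k ∈ A
        · simp [hk]
        · by_cases hkj : k = j <;> simp [hk, hkj, hj]
      have hc := Finset.sum_add_sum_compl (insert j A) y
      simp only [Fin.reduceFinMk, this]
      linarith

/-- Uniform distributions on `[0, y_k]` whose lengths satisfy the polygon inequality are jointly
mixable (in dual form). -/
theorem polygon_uniform {ι : Type*} [Fintype ι] [DecidableEq ι] {e : ι → ℝ → ℝ}
    (he : ∀ k, Continuous (e k)) {y : ι → ℝ} {E u : ℝ}
    (hy : ∀ k, 0 ≤ y k) (hyE : ∀ k, y k ≤ E) (hE : 0 ≤ E) (hsum : ∑ k, y k = 2 * E)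
    (h : ∀ d : ι → ℝ, (∀ k, d k ∈ Icc 0 (y k)) → ∑ k, d k = E → u ≤ ∑ k, e k (d k)) :
    u ≤ ∑ k, ∫ v in (0 : ℝ)..1, e k (y k * v) := by
  obtain ⟨g, hg⟩ := exists_grouping hy hyE hE hsum
  have main := triangle_uniform (e := fun i v => ∑ k with g k = i, e k (y k * v))
    (p := fun i => ∑ k with g k = i, y k) (E := E) (u := u)
    (fun i => continuous_finsetSum _ fun k _ => (he k).comp (by fun_prop))
    (fun i => Finset.sum_nonneg fun k _ => hy k) hg
    (by rw [← hsum]; exact Finset.sum_fiberwise _ g y) ?_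
  · refine main.trans_eq ?_
    rw [← Finset.sum_fiberwise Finset.univ g]
    refine Finset.sum_congr rfl fun i _ => ?_
    exact intervalIntegral.integral_finsetSum fun k _ =>
      ((he k).comp (by fun_prop : Continuous fun v => y k * v)).intervalIntegrable _ _
  · intro s hs hsE
    have := h (fun k => y k * s (g k)) (fun k => ⟨mul_nonneg (hy k) (hs _).1,
      mul_le_of_le_one_right (hy k) (hs _).2⟩) ?_
    · refine this.trans_eq ?_
      rw [← Finset.sum_fiberwise Finset.univ g]
      refine Finset.sum_congr rfl fun i _ => Finset.sum_congr rfl fun k hk => ?_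
      rw [(Finset.mem_filter.1 hk).2]
    · rw [← hsE, ← Finset.sum_fiberwise Finset.univ g]
      refine Finset.sum_congr rfl fun i _ => ?_
      rw [Finset.sum_mul]
      refine Finset.sum_congr rfl fun k hk => ?_
      rw [(Finset.mem_filter.1 hk).2]

/-! ### Tails at a minimizer of the average -/

theorem continuous_average {e : ℝ → ℝ} (he : Continuous e) :
    Continuous fun t : ℝ => ∫ v in (0 : ℝ)..1, e (t * v) :=
  intervalIntegral.continuous_parametric_intervalIntegral_of_continuous'
    (f := fun t v => e (t * v)) (he.comp (by fun_prop)) 0 1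

theorem mul_average (e : ℝ → ℝ) (t : ℝ) :
    t * ∫ v in (0 : ℝ)..1, e (t * v) = ∫ x in (0 : ℝ)..t, e x := by
  simp

/-- If the average over `[0, t]` is minimal at `t`, then the averages over `[t - y, t]` do not
exceed it. -/
theorem average_tail_le {e : ℝ → ℝ} (he : Continuous e) {t m : ℝ}
    (hm : ∀ x ∈ Icc 0 t, m ≤ ∫ v in (0 : ℝ)..1, e (x * v))
    (htm : ∫ v in (0 : ℝ)..1, e (t * v) = m) {y : ℝ} (hy : y ∈ Icc 0 t) :
    ∫ v in (0 : ℝ)..1, e (t - y * v) ≤ m := by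
  have hpos : ∀ y ∈ Ioc 0 t, ∫ v in (0 : ℝ)..1, e (t - y * v) ≤ m := by
    intro y hy
    have h1 := intervalIntegral.mul_integral_comp_sub_mul (f := e) (a := 0) (b := 1) y t
    have h2 := intervalIntegral.integral_add_adjacent_intervals
      (he.intervalIntegrable (μ := volume) 0 (t - y)) (he.intervalIntegrable (t - y) t)
    have h3 := mul_average e t
    have h4 := mul_average e (t - y)
    have h5 := mul_le_mul_of_nonneg_left (hm (t - y) ⟨by linarith [hy.2], by linarith [hy.1]⟩)
      (sub_nonneg.2 hy.2)
    rw [htm] at h3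
    rw [mul_one, mul_zero, sub_zero] at h1
    refine le_of_mul_le_mul_left ?_ hy.1
    nlinarith
  -- At y = 0 the tail is a point; for t > 0 the bound follows by continuity from y > 0.
  rcases eq_or_lt_of_le hy.1 with h0 | h0
  · subst h0
    rcases eq_or_lt_of_le hy.2 with ht | ht
    · simpa [← ht] using htm.le
    · have hcont : Continuous fun y : ℝ => ∫ v in (0 : ℝ)..1, e (t - y * v) :=
        intervalIntegral.continuous_parametric_intervalIntegral_of_continuous'
          (f := fun y v => e (t - y * v)) (he.comp (by fun_prop)) 0 1
      have hcl : closure (Ioc 0 t) ⊆ {y | ∫ v in (0 : ℝ)..1, e (t - y * v) ≤ m} :=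
        closure_minimal hpos (isClosed_le hcont continuous_const)
      rw [closure_Ioc ht.ne] at hcl
      exact hcl hy
  · exact hpos y ⟨h0, hy.2⟩

/-- If two t_k reach E, they suffice. If only t_i does, the others sum to C + E - t_i ≥ E. If none
does, the sum is C + E ≥ 2E. -/
theorem two_mul_excess_le {ι : Type*} [Fintype ι] [DecidableEq ι] {t : ι → ℝ} {C E : ℝ}
    (ht : ∀ k, 0 ≤ t k) (htC : ∀ k, t k ≤ C) (hsum : ∑ k, t k = C + E) (hE : 0 ≤ E)
    (hEC : E ≤ C) : 2 * E ≤ ∑ k, min (t k) E := by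
  by_cases h1 : ∃ i, E ≤ t i
  · obtain ⟨i, hi⟩ := h1
    rw [← Finset.add_sum_erase _ _ (Finset.mem_univ i)] at hsum ⊢
    rw [min_eq_right hi]
    suffices E ≤ ∑ k ∈ Finset.univ.erase i, min (t k) E by linarith
    by_cases h2 : ∃ j ∈ Finset.univ.erase i, E ≤ t j
    · obtain ⟨j, hj, hjE⟩ := h2
      calc E = min (t j) E := (min_eq_right hjE).symm
        _ ≤ _ := Finset.single_le_sum (f := fun k => min (t k) E)
          (fun k _ => le_min (ht k) hE) hj
    · push Not at h2
      rw [Finset.sum_congr rfl fun k hk => min_eq_left (h2 k hk).le]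
      linarith [htC i]
  · push Not at h1
    rw [Finset.sum_congr rfl fun k _ => min_eq_left (h1 k).le]
    linarith

/-- With excess E = ∑ t_k - C, tails of lengths y_k ≤ min(t_k, E) and total 2E satisfy the polygon
inequality. Uniform deductions d_k from t_k can thus be coupled to have sum E, which gives points of
sum C, while each tail average is at most m_k. -/
theorem le_sum_min_averages {ι : Type*} [Fintype ι] [DecidableEq ι] {e : ι → ℝ → ℝ}
    (he : ∀ k, Continuous (e k)) {t m : ι → ℝ} {C u : ℝ}
    (ht : ∀ k, 0 ≤ t k) (htC : ∀ k, t k ≤ C) (hT : C ≤ ∑ k, t k) (hT' : ∑ k, t k ≤ 2 * C)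
    (hm : ∀ k, ∀ x ∈ Icc 0 (t k), m k ≤ ∫ v in (0 : ℝ)..1, e k (x * v))
    (htm : ∀ k, ∫ v in (0 : ℝ)..1, e k (t k * v) = m k)
    (h : ∀ x : ι → ℝ, (∀ k, x k ∈ Icc 0 (t k)) → ∑ k, x k = C → u ≤ ∑ k, e k (x k)) :
    u ≤ ∑ k, m k := by
  obtain ⟨E, hE⟩ : ∃ E, E = ∑ k, t k - C := ⟨_, rfl⟩
  have hE0 : 0 ≤ E := by linarith
  have hS := two_mul_excess_le ht htC (E := E) (by linarith) hE0 (by linarith)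
  set S := ∑ k, min (t k) E with hSdef
  -- θ shrinks the capped lengths to total exactly 2E; if S = 0 then E = 0 too.
  obtain ⟨θ, hθ0, hθ1, hθ⟩ : ∃ θ : ℝ, 0 ≤ θ ∧ θ ≤ 1 ∧ θ * S = 2 * E := by
    rcases eq_or_lt_of_le (show 0 ≤ S by linarith) with h0 | h0
    · exact ⟨0, le_rfl, zero_le_one, by linarith⟩
    · exact ⟨2 * E / S, by positivity, div_le_one_of_le₀ hS h0.le, by field_simp⟩
  have hz : ∀ k, 0 ≤ min (t k) E := fun k => le_min (ht k) hE0
  have hzle : ∀ k, θ * min (t k) E ≤ min (t k) E := fun k => mul_le_of_le_one_left (hz k) hθ1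
  have hyt : ∀ k, θ * min (t k) E ≤ t k := fun k => (hzle k).trans (min_le_left _ _)
  have key := polygon_uniform (e := fun k d => e k (t k - d)) (y := fun k => θ * min (t k) E)
    (E := E) (u := u) (fun k => (he k).comp (by fun_prop)) (fun k => mul_nonneg hθ0 (hz k))
    (fun k => (hzle k).trans (min_le_right _ _)) hE0 (by rw [← Finset.mul_sum, hθ])
    (fun d hd hdE => h _ (fun k => ⟨by linarith [(hd k).2, hyt k], by linarith [(hd k).1]⟩)
      (by rw [Finset.sum_sub_distrib, hdE]; linarith))
  exact key.trans (Finset.sum_le_sum fun k _ =>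
    average_tail_le (he k) (hm k) (htm k) ⟨mul_nonneg hθ0 (hz k), hyt k⟩)

/-! ### Choice of the multiplier -/

/-- Replacing the entries of t' by those of t one at a time raises the sum by at most C per step, so
the first sum above C is at most 2C. -/
theorem exists_hybrid_sum {ι : Type*} [Fintype ι] [DecidableEq ι] {t t' : ι → ℝ} {C : ℝ}
    (h : C ≤ ∑ k, t k) (h' : ∑ k, t' k ≤ C) (hd : ∀ k, t k - t' k ≤ C) (hC : 0 ≤ C) :
    ∃ s : Finset ι, C ≤ ∑ k, s.piecewise t t' k ∧ ∑ k, s.piecewise t t' k ≤ 2 * C := by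
  obtain ⟨s, hs⟩ := (Set.toFinite {s : Finset ι | ∑ k, s.piecewise t t' k ≤ C}).exists_maximal
    ⟨∅, by simpa using h'⟩
  have hsC : ∑ k, s.piecewise t t' k ≤ C := hs.prop
  by_cases hU : s = Finset.univ
  · subst hU
    refine ⟨Finset.univ, by simpa using h, by linarith⟩
  · obtain ⟨j, hj⟩ : ∃ j, j ∉ s := by
      by_contra! hh
      exact hU (Finset.eq_univ_iff_forall.2 hh)
    refine ⟨insert j s, ?_, ?_⟩
    · by_contra! hh
      exact hj (hs.le_of_ge (y := insert j s) hh.le (Finset.subset_insert j s)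
        (Finset.mem_insert_self j s))
    · have hstep : ∑ k, (insert j s).piecewise t t' k =
          ∑ k, s.piecewise t t' k + (t j - t' j) := by
        rw [← Finset.add_sum_erase _ _ (Finset.mem_univ j),
          ← Finset.add_sum_erase _ (s.piecewise t t') (Finset.mem_univ j)]
        have : ∑ k ∈ Finset.univ.erase j, (insert j s).piecewise t t' k =
            ∑ k ∈ Finset.univ.erase j, s.piecewise t t' k :=
          Finset.sum_congr rfl fun k hk => by
            simp [Finset.piecewise, Finset.ne_of_mem_erase hk]
        rw [this, Finset.piecewise_eq_of_mem _ _ _ (Finset.mem_insert_self j s),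
          Finset.piecewise_eq_of_notMem _ _ _ hj]
        ring
      linarith [hd j]

/-- There is a slope `c` for which the functions `G_k(x) - c x` on `[0, r_k]` have minimizers
`t_k` with `C ≤ ∑ t_k ≤ 2 C`. -/
theorem exists_slope {ι : Type*} [Fintype ι] [DecidableEq ι] {G : ι → ℝ → ℝ}
    (hG : ∀ k, Continuous (G k)) {r : ι → ℝ} {C : ℝ} (hr : ∀ k, 0 ≤ r k) (hrC : ∀ k, r k ≤ C)
    (hC : 0 ≤ C) (hsum : 2 * C ≤ ∑ k, r k) :
    ∃ (c : ℝ) (t : ι → ℝ), (∀ k, t k ∈ Icc 0 (r k)) ∧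
      (∀ k, ∀ x ∈ Icc 0 (r k), G k (t k) - c * t k ≤ G k x - c * x) ∧
      C ≤ ∑ k, t k ∧ ∑ k, t k ≤ 2 * C := by
  rcases eq_or_lt_of_le hC with hC0 | hC0
  · subst hC0
    refine ⟨0, fun _ => 0, fun k => ⟨le_rfl, hr k⟩, fun k x hx => ?_, by simp, by simp⟩
    have : x = 0 := le_antisymm (hx.2.trans (hrC k)) hx.1
    simp [this]
  let Q : Set (ι → ℝ) := univ.pi fun k => Icc 0 (r k)
  have hQ : CompactSpace Q :=
    isCompact_iff_compactSpace.1 (isCompact_univ_pi fun _ => isCompact_Icc)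
  let M : ℝ → (ι → ℝ) → Prop := fun c t =>
    ∀ k, ∀ x ∈ Icc 0 (r k), G k (t k) - c * t k ≤ G k x - c * x
  have hMcl : IsClosed {p : Q × ℝ | M p.2 p.1.1} := by
    have : {p : Q × ℝ | M p.2 p.1.1} = ⋂ k, ⋂ x ∈ Icc 0 (r k),
        {p : Q × ℝ | G k (p.1.1 k) - p.2 * p.1.1 k ≤ G k x - p.2 * x} := by
      ext p; simp only [M, mem_iInter]; rfl
    rw [this]
    refine isClosed_iInter fun k => isClosed_biInter fun x _ => ?_
    have hk : Continuous fun p : Q × ℝ => p.1.1 k :=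
      (continuous_apply k).comp (continuous_subtype_val.comp continuous_fst)
    exact isClosed_le (((hG k).comp hk).sub (continuous_snd.mul hk)) (by fun_prop)
  have hTcont : Continuous fun p : Q × ℝ => ∑ k, p.1.1 k :=
    continuous_finsetSum _ fun k _ =>
      (continuous_apply k).comp (continuous_subtype_val.comp continuous_fst)
  -- A and B are the slopes with a minimizer of sum at least C, respectively at most C. They are
  -- closed, as projections along a compact factor, and cover ℝ, so by connectedness they share a
  -- slope; two minimizers for that slope are then hybridized.
  let A : Set ℝ := Prod.snd '' ({p : Q × ℝ | M p.2 p.1.1} ∩ {p | C ≤ ∑ k, p.1.1 k})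
  let B : Set ℝ := Prod.snd '' ({p : Q × ℝ | M p.2 p.1.1} ∩ {p | ∑ k, p.1.1 k ≤ C})
  have hA : IsClosed A :=
    isClosedMap_snd_of_compactSpace _ (hMcl.inter (isClosed_le continuous_const hTcont))
  have hB : IsClosed B :=
    isClosedMap_snd_of_compactSpace _ (hMcl.inter (isClosed_le hTcont continuous_const))
  have hex : ∀ c, ∃ t : Q, M c t.1 := by
    intro c
    have : ∀ k, ∃ s ∈ Icc 0 (r k), ∀ x ∈ Icc 0 (r k), G k s - c * s ≤ G k x - c * x := fun k => by
      obtain ⟨s, hs, hmin⟩ := isCompact_Icc.exists_isMinOn (nonempty_Icc.2 (hr k))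
        (f := fun x => G k x - c * x) ((hG k).sub (by fun_prop)).continuousOn
      exact ⟨s, hs, fun x hx => hmin hx⟩
    choose t ht ht' using this
    exact ⟨⟨t, fun k _ => ht k⟩, ht'⟩
  have hAB : univ ⊆ A ∪ B := fun c _ => by
    obtain ⟨t, ht⟩ := hex c
    rcases le_total C (∑ k, t.1 k) with h | h
    · exact Or.inl ⟨(t, c), ⟨ht, h⟩, rfl⟩
    · exact Or.inr ⟨(t, c), ⟨ht, h⟩, rfl⟩
  have hbd : ∀ k, ∃ b, ∀ x ∈ Icc 0 (r k), |G k x| ≤ b := fun k =>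
    isCompact_Icc.exists_bound_of_continuousOn (hG k).continuousOn
  choose b hb using hbd
  have hb0 : ∀ k, 0 ≤ b k := fun k => (abs_nonneg _).trans (hb k 0 ⟨le_rfl, hr k⟩)
  -- At slope c the linear term beats the oscillation of the G_k: minimizers fall short of ∑ r_k ≥
  -- 2C by at most C. At slope -c their sum is at most C.
  obtain ⟨c, hc⟩ : ∃ c, c = 2 * (∑ k, b k) / C + 1 := ⟨_, rfl⟩
  have hbsum : 0 ≤ ∑ k, b k := Finset.sum_nonneg fun k _ => hb0 k
  have hc0 : 0 < c := by rw [hc]; positivity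
  have hcC : 2 * ∑ k, b k ≤ c * C := by
    rw [hc, add_mul, div_mul_cancel₀ _ hC0.ne']; linarith
  have hAne : (univ ∩ A).Nonempty := by
    obtain ⟨t, ht⟩ := hex c
    refine ⟨c, mem_univ _, (t, c), ⟨ht, ?_⟩, rfl⟩
    change C ≤ ∑ k, t.1 k
    have hle : c * (∑ k, r k - ∑ k, t.1 k) ≤ c * C := by
      refine le_trans ?_ hcC
      rw [← Finset.sum_sub_distrib, Finset.mul_sum, Finset.mul_sum]
      refine Finset.sum_le_sum fun k _ => ?_
      have h1 := ht k (r k) ⟨hr k, le_rfl⟩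
      have h2 := abs_le.1 (hb k (r k) ⟨hr k, le_rfl⟩)
      have h3 := abs_le.1 (hb k (t.1 k) (t.2 k (mem_univ k)))
      linarith
    have := le_of_mul_le_mul_left hle hc0
    linarith
  have hBne : (univ ∩ B).Nonempty := by
    obtain ⟨t, ht⟩ := hex (-c)
    refine ⟨-c, mem_univ _, (t, -c), ⟨ht, ?_⟩, rfl⟩
    change ∑ k, t.1 k ≤ C
    have hle : c * ∑ k, t.1 k ≤ c * C := by
      refine le_trans ?_ hcC
      rw [Finset.mul_sum, Finset.mul_sum]
      refine Finset.sum_le_sum fun k _ => ?_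
      have h1 := ht k 0 ⟨le_rfl, hr k⟩
      have h2 := abs_le.1 (hb k 0 ⟨le_rfl, hr k⟩)
      have h3 := abs_le.1 (hb k (t.1 k) (t.2 k (mem_univ k)))
      linarith
    exact le_of_mul_le_mul_left hle hc0
  obtain ⟨c', -, ⟨⟨t, _⟩, ⟨ht, htC⟩, rfl⟩, ⟨⟨t', d⟩, ⟨ht', htC'⟩, hd⟩⟩ :=
    isPreconnected_closed_iff.1 isPreconnected_univ A B hA hB hAB hAne hBne
  dsimp only at hd
  subst hd
  obtain ⟨s, hs, hs'⟩ := exists_hybrid_sum (t := t.1) (t' := t'.1) htC htC'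
    (fun k => by
      have h1 := (t.2 k (mem_univ k)).2
      have h2 := (t'.2 k (mem_univ k)).1
      linarith [hrC k]) hC
  refine ⟨d, s.piecewise t.1 t'.1, fun k => ?_, fun k => ?_, hs, hs'⟩
  · by_cases hk : k ∈ s
    · simpa [hk] using t.2 k (mem_univ k)
    · simpa [hk] using t'.2 k (mem_univ k)
  · by_cases hk : k ∈ s
    · simpa only [Finset.piecewise_eq_of_mem _ _ _ hk] using ht k
    · simpa only [Finset.piecewise_eq_of_notMem _ _ _ hk] using ht' k

/-! ### Decreasing measures as mixtures of uniform laws -/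

/-- A measure consisting of an atom at `l` and a part on `[l, r]` with nonincreasing density. -/
def IsDecreasingOn (l r : ℝ) (μ : Measure ℝ) : Prop :=
  ∃ (α : ℝ≥0) (ρ : ℝ → ℝ≥0∞), Antitone ρ ∧
    μ = α • Measure.dirac l + (volume.restrict (Icc l r)).withDensity ρ

theorem le_of_mem_decreasing {l r : ℝ} {μ : ProbabilityMeasure ℝ} (h : μ ∈ decreasing l r) :
    l ≤ r := by
  rcases h.2 with ⟨h, -⟩ | ⟨h, -⟩
  exacts [h.le, h.le]

theorem isDecreasingOn_of_mem_decreasing {l r : ℝ} {μ : ProbabilityMeasure ℝ}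
    (h : μ ∈ decreasing l r) : IsDecreasingOn l r (μ : Measure ℝ) := by
  rcases h.2 with ⟨-, h⟩ | ⟨hlr, α, β, -, μ', ⟨-, ρ, hρ, hμ'⟩, h⟩
  · exact ⟨1, fun _ => 0, fun _ _ _ => le_rfl, by
      rw [h, one_smul, show (fun _ : ℝ => (0 : ℝ≥0∞)) = 0 from rfl, withDensity_zero, add_zero]⟩
  -- Composing with the projection onto [l, r] makes the density antitone on all of ℝ, hence
  -- measurable.
  · have hanti : Antitone fun x => (β : ℝ≥0∞) * ρ (projIcc l r hlr.le x) := fun x y hxy =>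
      mul_le_mul_right (hρ (projIcc l r hlr.le x).2 (projIcc l r hlr.le y).2
        (monotone_projIcc hlr.le hxy)) _
    refine ⟨α, _, hanti, ?_⟩
    have hρm : Measurable fun x => ρ (projIcc l r hlr.le x) := by
      refine Antitone.measurable fun x y hxy => ?_
      exact hρ (projIcc l r hlr.le x).2 (projIcc l r hlr.le y).2 (monotone_projIcc hlr.le hxy)
    rw [h, hμ']
    congr 1
    have hcongr : (volume.restrict (Icc l r)).withDensity ρ =
        (volume.restrict (Icc l r)).withDensity fun x => ρ (projIcc l r hlr.le x) := by
      refine withDensity_congr_ae ?_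
      filter_upwards [ae_restrict_mem measurableSet_Icc] with x hx
      rw [projIcc_of_mem hlr.le hx]
    rw [hcongr]
    exact (withDensity_smul (β : ℝ≥0∞) hρm).symm

theorem IsDecreasingOn.trim {l r b : ℝ} {μ : Measure ℝ} (h : IsDecreasingOn l r μ) (hb : μ (Iic b)ᶜ = 0) : IsDecreasingOn l (min r b) μ := by
  obtain ⟨α, ρ, hρ, rfl⟩ := h
  refine ⟨α, ρ, hρ, ?_⟩
  have hae : ∀ᵐ x ∂(volume.restrict (Icc l r)).withDensity ρ, x ∈ Iic b := by
    change _ = _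
    rw [Measure.add_apply] at hb
    exact (add_eq_zero.1 hb).2
  have h1 := Measure.restrict_eq_self_of_ae_mem hae
  rw [restrict_withDensity measurableSet_Iic, Measure.restrict_restrict measurableSet_Iic,
    inter_comm,
    show Icc l r ∩ Iic b = Icc l (min r b) by ext; simp [and_assoc]] at h1
  rw [h1]

/-- If l < a, there is no atom and the density vanishes at some point just right of l; being
antitone, it vanishes from there on, and no mass is left. -/
theorem IsDecreasingOn.le_left {l r a : ℝ} {μ : Measure ℝ} [IsProbabilityMeasure μ]
    (h : IsDecreasingOn l r μ) (ha : μ (Ici a)ᶜ = 0) : a ≤ l := by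
  by_contra! hla
  obtain ⟨α, ρ, hρ, hμ⟩ := h
  have huniv := measure_univ (μ := μ)
  rw [hμ, Measure.add_apply, Measure.smul_apply] at ha huniv
  obtain ⟨h1, h2⟩ := add_eq_zero.1 ha
  rw [Measure.dirac_apply' _ measurableSet_Ici.compl, indicator_of_mem (by simpa using hla)] at h1
  have hα : (α : ℝ≥0∞) = 0 := by simpa [ENNReal.smul_def] using h1
  rw [ENNReal.smul_def, hα, zero_smul, zero_add] at huniv
  set ν := (volume.restrict (Icc l r)).withDensity ρ with hν
  rcases le_or_gt r l with hrl | hlr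
  · have : volume.restrict (Icc l r) = 0 := by
      rw [Measure.restrict_eq_zero, Real.volume_Icc, ENNReal.ofReal_eq_zero]; linarith
    rw [hν, this] at huniv
    simp at huniv
  · obtain ⟨x, hlx, hx⟩ := exists_between (lt_min hla hlr)
    have hxa : x < a := hx.trans_le (min_le_left _ _)
    have hxr : x < r := hx.trans_le (min_le_right _ _)
    have hsub : ν (Icc l x) = 0 := measure_mono_null (fun y hy => by
      simpa using hy.2.trans_lt hxa) h2
    have hle : ρ x * volume (Icc l x) ≤ ν (Icc l x) := by
      rw [hν, withDensity_apply _ measurableSet_Icc, Measure.restrict_restrict measurableSet_Icc,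
        inter_eq_left.2 (Icc_subset_Icc_right hxr.le), ← setLIntegral_const]
      exact setLIntegral_mono hρ.measurable fun y hy => hρ hy.2
    rw [hsub, nonpos_iff_eq_zero, mul_eq_zero, Real.volume_Icc, ENNReal.ofReal_eq_zero] at hle
    have hρx : ρ x = 0 := hle.resolve_right (by linarith)
    have hsub' : ν (Ici x) = 0 := by
      rw [hν, withDensity_apply _ measurableSet_Ici]
      refine (setLIntegral_congr_fun measurableSet_Ici fun y hy => ?_).trans lintegral_zero
      exact nonpos_iff_eq_zero.1 (hρx ▸ hρ hy)
    have hlow : ν (Iio x) = 0 := measure_mono_null (fun y hy => by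
      simpa using lt_trans hy hxa) h2
    have : ν univ = 0 := by
      rw [← Iio_union_Ici (a := x)]
      exact measure_union_null hlow hsub'
    rw [this] at huniv
    exact zero_ne_one huniv

theorem lintegral_neg_le_of_integral_nonneg {ν : Measure ℝ} {h : ℝ → ℝ} (hi : Integrable h ν)
    (h0 : 0 ≤ ∫ x, h x ∂ν) :
    ∫⁻ x, ENNReal.ofReal (-h x) ∂ν ≤ ∫⁻ x, ENNReal.ofReal (h x) ∂ν := by
  rw [integral_eq_lintegral_pos_part_sub_lintegral_neg_part hi, sub_nonneg] at h0
  exact (ENNReal.toReal_le_toReal hi.neg.lintegral_lt_top.ne hi.lintegral_lt_top.ne).1 h0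

theorem integral_nonneg_of_lintegral_neg_le {ν : Measure ℝ} {h : ℝ → ℝ} (hi : Integrable h ν)
    (h0 : ∫⁻ x, ENNReal.ofReal (-h x) ∂ν ≤ ∫⁻ x, ENNReal.ofReal (h x) ∂ν) :
    0 ≤ ∫ x, h x ∂ν := by
  rw [integral_eq_lintegral_pos_part_sub_lintegral_neg_part hi, sub_nonneg]
  exact ENNReal.toReal_mono hi.lintegral_lt_top.ne h0

theorem volume_setOf_ofReal_lt (y : ℝ≥0∞) :
    volume {s : ℝ | 0 < s ∧ ENNReal.ofReal s < y} = y := by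
  induction y with
  | top =>
    have : {s : ℝ | 0 < s ∧ ENNReal.ofReal s < ⊤} = Ioi 0 := by ext; simp
    rw [this, Real.volume_Ioi]
  | coe y =>
    have : {s : ℝ | 0 < s ∧ ENNReal.ofReal s < y} = Ioo 0 (y : ℝ) := by
      ext s
      refine and_congr_right fun hs => ?_
      rw [← ENNReal.ofReal_coe_nnreal, ENNReal.ofReal_lt_ofReal_iff_of_nonneg hs.le]
    rw [this, Real.volume_Ioo, sub_zero, ENNReal.ofReal_coe_nnreal]

/-- Layer cake: ρ x is the length of {s > 0 : s < ρ x}, and Tonelli exchanges the integrals. It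
holds also where ρ is infinite. -/
theorem lintegral_mul_eq_lintegral_superlevel {ν : Measure ℝ} [SFinite ν] {ρ g : ℝ → ℝ≥0∞}
    (hρ : Measurable ρ) (hg : Measurable g) :
    ∫⁻ x, ρ x * g x ∂ν =
      ∫⁻ s in Ioi (0 : ℝ), ∫⁻ x in {x | ENNReal.ofReal s < ρ x}, g x ∂ν := by
  have hm : MeasurableSet {p : ℝ × ℝ | 0 < p.2 ∧ ENNReal.ofReal p.2 < ρ p.1} :=
    (measurableSet_lt measurable_const measurable_snd).inter
      (measurableSet_lt (ENNReal.measurable_ofReal.comp measurable_snd) (hρ.comp measurable_fst))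
  have h1 : ∀ x, ρ x * g x = ∫⁻ s : ℝ,
      {p : ℝ × ℝ | 0 < p.2 ∧ ENNReal.ofReal p.2 < ρ p.1}.indicator (fun p => g p.1) (x, s) := by
    intro x
    have hmx : MeasurableSet {s : ℝ | 0 < s ∧ ENNReal.ofReal s < ρ x} :=
      measurable_prodMk_left hm
    calc ρ x * g x = ∫⁻ s : ℝ, {s : ℝ | 0 < s ∧ ENNReal.ofReal s < ρ x}.indicator
          (fun _ => g x) s := by
          rw [lintegral_indicator_const hmx, volume_setOf_ofReal_lt, mul_comm]
      _ = _ := rfl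
  simp_rw [h1]
  rw [lintegral_lintegral_swap
    (f := fun x s => {p : ℝ × ℝ | 0 < p.2 ∧ ENNReal.ofReal p.2 < ρ p.1}.indicator
      (fun p => g p.1) (x, s)) ((hg.comp measurable_fst).indicator hm).aemeasurable,
    ← lintegral_indicator measurableSet_Ioi]
  refine lintegral_congr fun s => ?_
  by_cases hs : 0 < s
  · rw [indicator_of_mem (show s ∈ Ioi 0 from hs), ← lintegral_indicator (measurableSet_lt measurable_const hρ)]
    refine lintegral_congr fun x => ?_
    simp [indicator, hs]
  · rw [indicator_of_notMem (by simpa using hs)]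
    refine (lintegral_congr fun x => ?_).trans lintegral_zero
    exact indicator_of_notMem (fun hh => hs hh.1) _

/-- An initial segment of `[l, r]` is, up to a null set, empty or of the form `[l, t]`. -/
theorem initial_segment_ae_eq {l r : ℝ} {J : Set ℝ} (hJ : J ⊆ Icc l r)
    (hJ' : ∀ x ∈ J, Icc l x ⊆ J) :
    J = ∅ ∨ ∃ t ∈ Icc l r, J =ᵐ[volume] Icc l t := by
  rcases J.eq_empty_or_nonempty with h | ⟨x, hx⟩
  · exact Or.inl h
  right
  have hbdd : BddAbove J := bddAbove_Icc.mono hJ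
  refine ⟨sSup J, ⟨(hJ hx).1.trans (le_csSup hbdd hx),
    csSup_le ⟨x, hx⟩ fun y hy => (hJ hy).2⟩, ?_⟩
  have h1 : J ⊆ Icc l (sSup J) := fun y hy => ⟨(hJ hy).1, le_csSup hbdd hy⟩
  have h2 : Ico l (sSup J) ⊆ J := fun y hy => by
    obtain ⟨z, hz, hyz⟩ := exists_lt_of_lt_csSup ⟨x, hx⟩ hy.2
    exact hJ' z hz ⟨hy.1, hyz.le⟩
  exact (LE.le.eventuallyLE h1).antisymm
    (Ico_ae_eq_Icc.symm.le.trans (LE.le.eventuallyLE h2))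

/-- Superlevel sets of an antitone density are initial segments of [l, r], on each of which h has
nonnegative integral. Positive and negative parts are compared layer by layer in [0, ∞], where
Tonelli needs no integrability. -/
theorem integral_withDensity_antitone_nonneg {l r : ℝ} {ρ : ℝ → ℝ≥0∞} (hρ : Antitone ρ)
    {h : ℝ → ℝ} (hc : Continuous h)
    (hi : Integrable h ((volume.restrict (Icc l r)).withDensity ρ))
    (h0 : ∀ t ∈ Icc l r, 0 ≤ ∫ x in l..t, h x) :
    0 ≤ ∫ x, h x ∂(volume.restrict (Icc l r)).withDensity ρ := by
  refine integral_nonneg_of_lintegral_neg_le hi ?_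
  have hm1 : Measurable fun x => ENNReal.ofReal (h x) := hc.measurable.ennreal_ofReal
  have hm2 : Measurable fun x => ENNReal.ofReal (-h x) := hc.measurable.neg.ennreal_ofReal
  rw [lintegral_withDensity_eq_lintegral_mul _ hρ.measurable hm1,
    lintegral_withDensity_eq_lintegral_mul _ hρ.measurable hm2]
  simp only [Pi.mul_apply]
  rw [lintegral_mul_eq_lintegral_superlevel hρ.measurable hm1,
    lintegral_mul_eq_lintegral_superlevel hρ.measurable hm2]
  refine lintegral_mono fun s => ?_
  have hms : MeasurableSet {x | ENNReal.ofReal s < ρ x} :=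
    measurableSet_lt measurable_const hρ.measurable
  rw [Measure.restrict_restrict hms]
  rcases initial_segment_ae_eq (l := l) (r := r) (J := {x | ENNReal.ofReal s < ρ x} ∩ Icc l r)
    inter_subset_right (fun x hx y hy => ⟨lt_of_lt_of_le hx.1 (hρ hy.2), hy.1, hy.2.trans hx.2.2⟩)
    with hJ | ⟨t, ht, hJ⟩
  · rw [hJ]; simp
  · rw [Measure.restrict_congr_set hJ]
    refine lintegral_neg_le_of_integral_nonneg hc.integrableOn_Icc ?_
    rw [integral_Icc_eq_integral_Ioc, ← intervalIntegral.integral_of_le ht.1]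
    exact h0 t ht

theorem integrable_of_ae_mem_Icc {μ : Measure ℝ} [IsFiniteMeasure μ] {a b : ℝ}
    (hμ : μ (Icc a b)ᶜ = 0) {h : ℝ → ℝ} (hc : Continuous h) : Integrable h μ := by
  rw [← Measure.restrict_eq_self_of_ae_mem (s := Icc a b) hμ]
  exact hc.integrableOn_Icc

theorem IsDecreasingOn.integral_nonneg {l r : ℝ} (hlr : l ≤ r) {μ : Measure ℝ}
    (hμ : IsDecreasingOn l r μ) {h : ℝ → ℝ} (hc : Continuous h) (hi : Integrable h μ)
    (h0 : ∀ t ∈ Icc 0 (r - l), 0 ≤ ∫ v in (0 : ℝ)..1, h (l + t * v)) :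
    0 ≤ ∫ x, h x ∂μ := by
  obtain ⟨α, ρ, hρ, rfl⟩ := hμ
  obtain ⟨hi1, hi2⟩ := integrable_add_measure.1 hi
  rw [integral_add_measure hi1 hi2, integral_smul_nnreal_measure, integral_dirac]
  refine add_nonneg (smul_nonneg α.2 ?_) (integral_withDensity_antitone_nonneg hρ hc hi2 ?_)
  · simpa using h0 0 ⟨le_rfl, by linarith⟩
  · intro t ht
    have h1 := intervalIntegral.mul_integral_comp_add_mul (f := h) (a := 0) (b := 1) (t - l) l
    rw [mul_zero, add_zero, mul_one, add_sub_cancel] at h1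
    rw [← h1]
    exact mul_nonneg (by linarith [ht.1]) (h0 _ ⟨by linarith [ht.1], by linarith [ht.2]⟩)

/-- The average of (l + r)/2 - x over [l, l + t] is (r - l - t)/2 ≥ 0. -/
theorem IsDecreasingOn.integral_id_le {l r : ℝ} (hlr : l ≤ r) {μ : Measure ℝ}
    [IsProbabilityMeasure μ] (hμ : IsDecreasingOn l r μ) (hi : Integrable (fun x : ℝ => x) μ) :
    ∫ x, x ∂μ ≤ (l + r) / 2 := by
  have key := hμ.integral_nonneg hlr (h := fun x => (l + r) / 2 - x) (by fun_prop)
    ((integrable_const _).sub hi) fun t ht => by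
      have h1 : ∫ v in (0 : ℝ)..1, ((l + r) / 2 - (l + t * v)) = (r - l - t) / 2 := by
        rw [intervalIntegral.integral_sub (by simp)
          ((by fun_prop : Continuous fun v : ℝ => l + t * v).intervalIntegrable _ _),
          intervalIntegral.integral_add (by simp)
          ((by fun_prop : Continuous fun v : ℝ => t * v).intervalIntegrable _ _),
          intervalIntegral.integral_const_mul, integral_id]
        simp
        ring
      rw [h1]
      linarith [ht.2]
  rw [integral_sub (integrable_const _) hi] at key
  simpa using key

theorem average_sub_linear {f : ℝ → ℝ} (hf : Continuous f) (l c t : ℝ) :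
    ∫ v in (0 : ℝ)..1, (f (l + t * v) - 2 * c * (t * v)) =
      (∫ v in (0 : ℝ)..1, f (l + t * v)) - c * t := by
  rw [intervalIntegral.integral_sub
    ((by fun_prop : Continuous fun v : ℝ => f (l + t * v)).intervalIntegrable _ _)
    ((by fun_prop : Continuous fun v : ℝ => 2 * c * (t * v)).intervalIntegrable _ _),
    intervalIntegral.integral_const_mul, intervalIntegral.integral_const_mul, integral_id]
  ring

/-- If the averages of `f - 2 c (x - l)` over the intervals `[l, l + t]` are at least `m`, then so
is its integral. -/
theorem IsDecreasingOn.le_integral {l r : ℝ} (hlr : l ≤ r) {μ : Measure ℝ}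
    [IsProbabilityMeasure μ] (hμ : IsDecreasingOn l r μ) (hi : Integrable (fun x : ℝ => x) μ)
    {f : ℝ → ℝ} (hf : Continuous f) (hfi : Integrable f μ) {c m : ℝ}
    (h : ∀ t ∈ Icc 0 (r - l), m ≤ (∫ v in (0 : ℝ)..1, f (l + t * v)) - c * t) :
    m + 2 * c * (∫ x, x ∂μ - l) ≤ ∫ x, f x ∂μ := by
  have hi' : Integrable (fun x : ℝ => 2 * c * (x - l)) μ :=
    (hi.sub (integrable_const l)).const_mul _
  have hfs : Integrable (fun x : ℝ => f x - 2 * c * (x - l)) μ := hfi.sub hi'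
  have key := hμ.integral_nonneg hlr (h := fun x => f x - 2 * c * (x - l) - m) (by fun_prop)
    (hfs.sub (integrable_const _)) fun t ht => by
      have h1 := average_sub_linear hf l c t
      have h2 : ∫ v in (0 : ℝ)..1, (f (l + t * v) - 2 * c * (l + t * v - l) - m) =
          (∫ v in (0 : ℝ)..1, (f (l + t * v) - 2 * c * (t * v))) - m := by
        simp only [add_sub_cancel_left]
        rw [intervalIntegral.integral_sub
          ((by fun_prop : Continuous fun v : ℝ => f (l + t * v) - 2 * c * (t * v)).intervalIntegrable
            _ _) (by simp)]
        simp
      rw [h2, h1]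
      linarith [h t ht]
  rw [integral_sub hfs (integrable_const _), integral_sub hfi hi',
    integral_const_mul, integral_sub hi (integrable_const _)] at key
  simp only [integral_const, probReal_univ, one_smul] at key
  linarith

/-! ### The dual inequality and the conclusion -/

theorem dual_inequality {N : ℕ} (hN : 0 < N) {a b C : ℝ} {μ : Fin N → ProbabilityMeasure ℝ}
    (hμ : μ ∈ VOn N (Icc a b) C) (f : Fin N → ℝ →ᵇ ℝ) (u : ℝ)
    (hf : ∀ z ∈ slice N a b C, u ≤ ∑ k, f k (z k)) :
    u ≤ ∑ k, ∫ x, f k x ∂(μ k : Measure ℝ) := by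
  obtain ⟨⟨hmean, l, r, hlr, hdec⟩, hK⟩ := hμ
  have hK' : ∀ k, (μ k : Measure ℝ) (Icc a b)ᶜ = 0 := hK
  have hD : ∀ k, IsDecreasingOn (l k) (r k) (μ k : Measure ℝ) := fun k =>
    isDecreasingOn_of_mem_decreasing (hdec k)
  have hal : ∀ k, a ≤ l k := fun k => (hD k).le_left
    (measure_mono_null (compl_subset_compl.2 Icc_subset_Ici_self) (hK' k))
  have hlb : ∀ k, l k ≤ b := fun k => by
    have h1 : ∀ᵐ x ∂(μ k : Measure ℝ), x ∈ Icc a b := hK' k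
    have h2 : ∀ᵐ x ∂(μ k : Measure ℝ), x ∈ Icc (l k) (r k) := (hdec k).1
    obtain ⟨x, hx1, hx2⟩ := (h1.and h2).exists
    exact hx2.1.trans hx1.2
  -- Only the r k may leave K; cutting them at b keeps every test point l k + x k inside [a, b].
  have hT : ∀ k, IsDecreasingOn (l k) (min (r k) b) (μ k : Measure ℝ) := fun k =>
    (hD k).trim (measure_mono_null (compl_subset_compl.2 Icc_subset_Iic_self) (hK' k))
  have hlm : ∀ k, l k ≤ min (r k) b := fun k => le_min (le_of_mem_decreasing (hdec k)) (hlb k)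
  have hid : ∀ k, Integrable (fun x : ℝ => x) (μ k : Measure ℝ) := fun k =>
    integrable_of_ae_mem_Icc (hK' k) continuous_id
  obtain ⟨D, hDdef⟩ : ∃ D, D = C - ∑ i, l i := ⟨_, rfl⟩
  have hR : ∀ k, min (r k) b - l k ≤ D := fun k => by
    linarith [(hlr k).2, min_le_left (r k) b]
  have hR0 : ∀ k, 0 ≤ min (r k) b - l k := fun k => sub_nonneg.2 (hlm k)
  have hD0 : 0 ≤ D := (hR0 ⟨0, hN⟩).trans (hR _)
  -- Each mean is at most the midpoint of its interval, and the means sum to C.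
  have hsum : 2 * D ≤ ∑ k, (min (r k) b - l k) := by
    have := Finset.sum_le_sum fun k (_ : k ∈ Finset.univ) => (hT k).integral_id_le (hlm k) (hid k)
    rw [hmean, ← Finset.sum_div, Finset.sum_add_distrib] at this
    rw [Finset.sum_sub_distrib]
    linarith
  obtain ⟨c, t, ht, hmin, hDt, htD⟩ := exists_slope
    (G := fun k t => ∫ v in (0 : ℝ)..1, f k (l k + t * v))
    (fun k => continuous_average (e := fun x => f k (l k + x)) (by fun_prop)) hR0 hR hD0 hsum
  have havg : ∀ k x, ∫ v in (0 : ℝ)..1, (f k (l k + x * v) - 2 * c * (x * v)) =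
      (∫ v in (0 : ℝ)..1, f k (l k + x * v)) - c * x := fun k x =>
    average_sub_linear (f k).continuous (l k) c x
  have hsumm := le_sum_min_averages (e := fun k x => f k (l k + x) - 2 * c * x) (t := t)
    (m := fun k => (∫ v in (0 : ℝ)..1, f k (l k + t k * v)) - c * t k) (C := D)
    (u := u - 2 * c * D) (fun k => by fun_prop) (fun k => (ht k).1)
    (fun k => (ht k).2.trans (hR k)) hDt htD
    (fun k x hx => by
      rw [havg]
      exact hmin k x ⟨hx.1, hx.2.trans (ht k).2⟩)
    (fun k => havg k (t k))
    (fun x hx hxD => by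
      have := hf (fun k => l k + x k) ⟨fun k => ⟨by linarith [hal k, (hx k).1], by
        linarith [(hx k).2, (ht k).2, min_le_right (r k) b]⟩, by
        rw [Finset.sum_add_distrib, hxD]; linarith⟩
      rw [Finset.sum_sub_distrib, ← Finset.mul_sum, hxD]
      linarith)
  -- The means add 2cD in total, which cancels the -2cD in the lower bound `hsumm` for the sum of
  -- the minima.
  have hfin := Finset.sum_le_sum fun k (_ : k ∈ Finset.univ) =>
    (hT k).le_integral (hlm k) (hid k) (f k).continuous ((f k).integrable _) (hmin k)
  rw [Finset.sum_add_distrib, ← Finset.mul_sum, Finset.sum_sub_distrib (fun k => ∫ x, x ∂(μ k : Measure ℝ)),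
    hmean, ← hDdef] at hfin
  linarith

end FlatTuples

end

theorem mainTheorem3 (N : ℕ) (hN : 0 < N) (a b : ℝ) (hab : a ≤ b) (C : ℝ) :
    closedConvexHull ℝ (FlatTuples.toSignedTuple '' FlatTuples.VOn N (Set.Icc a b) C) =
      FlatTuples.toSignedTuple '' FlatTuples.F N (Set.Icc a b) C :=
  Set.Subset.antisymm
    (closedConvexHull_min
      (FlatTuples.VOn_subset_F_of_duality fun _ hμ => FlatTuples.dual_inequality hN hμ)
      (FlatTuples.convex_F N a b C) (FlatTuples.isClosed_F N a b C))
    (FlatTuples.F_subset_closedConvexHull N a b C)
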